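/- Let $H$ be a complex Hilbert space and let $T$ be a densely defined closed linear operator in $H$ with domain $D(T)$. Suppose that $T$ is totally paranormal, that is, $$\|(T-\lambda I)x\|^2\le \|(T-\lambda I)^2x\|\,\|x\|$$ for all $\lambda\in\mathbb{C}$ and all $x\in D((T-\lambda I)^2)=\{x\in D(T): (T-\lambda I)x\in D(T)\}$. Let $\sigma(T)$ be the complement of the set of all $z\in\mathbb{C}$ for which $T-zI:D(T)\to H$ is bijective with bounded inverse $H\to H$, and let $\mu$ be an isolated point of $\sigma(T)$. Then, for every $r>0$ such that $\{z\in\mathbb{C}:|z-\mu|\le r\}\cap\sigma(T)=\{\mu\}$, the resolvent $z\mapsto (zI-T)^{-1}$ is integrable in operator norm over the positively oriented circle $|z-\mu|=r$, and the Riesz projection $$E_\mu=\frac{1}{2\pi i}\int_{|z-\mu|=r}(zI-T)^{-1}\,dz$$ satisfies $$N(T-\mu I)=\operatorname{ran}(E_\mu),$$ where $N(T-\mu I)=\{x\in D(T): Tx=\mu x\}$. In particular, $\mu$ is an eigenvalue of $T$, i.e. $T-\mu I$ is not injective. -/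

import Mathlib

namespace LinearPMap

variable {H : Type*} [NormedAddCommGroup H] [InnerProductSpace ℂ H]

/-- The operator `T - z I`, with the same domain as `T`. -/
def subScalar (T : H →ₗ.[ℂ] H) (z : ℂ) : H →ₗ.[ℂ] H where
  domain := T.domain
  toFun := T.toFun - z • T.domain.subtype

@[simp]
theorem subScalar_apply (T : H →ₗ.[ℂ] H) (z : ℂ) (x : T.domain) :
    T.subScalar z x = T x - z • (x : H) := rfl

/-- The null space of `A`, as a subspace of the ambient space `H`. -/
def nullSpace (A : H →ₗ.[ℂ] H) : Submodule ℂ H :=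
  (LinearMap.ker A.toFun).map A.domain.subtype

/-- `S` is an everywhere defined bounded two-sided inverse of the operator `A`:
`S A x = x` for `x ∈ D(A)`, and for every `y ∈ H` one has `S y ∈ D(A)` and `A S y = y`. -/
def IsBoundedInverse (A : H →ₗ.[ℂ] H) (S : H →L[ℂ] H) : Prop :=
  (∀ x : A.domain, S (A x) = x) ∧ ∀ y : H, ∃ x : A.domain, (x : H) = S y ∧ A x = y

theorem IsBoundedInverse.unique {A : H →ₗ.[ℂ] H} {S S' : H →L[ℂ] H}
    (h : A.IsBoundedInverse S) (h' : A.IsBoundedInverse S') : S = S' := by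
  ext y
  obtain ⟨x, hx, hy⟩ := h.2 y
  rw [← hx, ← hy, h'.1 x]

/-- `ρ(T)`: the `z` for which `T - z I` is invertible with bounded inverse defined on all of `H`. -/
def resolventSet (T : H →ₗ.[ℂ] H) : Set ℂ :=
  {z | ∃ S : H →L[ℂ] H, (T.subScalar z).IsBoundedInverse S}

/-- The spectrum `σ(T) = ℂ \ ρ(T)`. -/
def spectrum (T : H →ₗ.[ℂ] H) : Set ℂ := T.resolventSetᶜ

/-- The point spectrum (the set of eigenvalues): the `z` for which `T - z I` is not injective. -/
def pointSpectrum (T : H →ₗ.[ℂ] H) : Set ℂ :=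
  {z | ¬ Function.Injective (T.subScalar z)}

open Classical in
/-- The resolvent `(z I - T)⁻¹ = -(T - z I)⁻¹` for `z ∈ ρ(T)`; the value is `0` for `z ∈ σ(T)`. -/
noncomputable def resolvent (T : H →ₗ.[ℂ] H) (z : ℂ) : H →L[ℂ] H :=
  if h : ∃ S : H →L[ℂ] H, (T.subScalar z).IsBoundedInverse S then -h.choose else 0

/-- `(2πi)⁻¹ ∮_{|z - μ| = r} (z I - T)⁻¹ dz`, the circle being positively oriented. This is the Riesz
projection of `T` at `μ` when `μ` is the only point of `σ(T)` in the closed disc `|z - μ| ≤ r`. -/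
noncomputable def rieszProjection (T : H →ₗ.[ℂ] H) (μ : ℂ) (r : ℝ) : H →L[ℂ] H :=
  (2 * (Real.pi : ℂ) * Complex.I)⁻¹ • circleIntegral T.resolvent μ r

/-- `‖(T - lI) x‖² ≤ ‖(T - lI)² x‖ ‖x‖` for all `l ∈ ℂ` and all `x` in the domain of `(T - lI)²`,
that is, all `x ∈ D(T)` such that `(T - lI) x ∈ D(T)`. -/
def IsTotallyParanormal (T : H →ₗ.[ℂ] H) : Prop :=
  ∀ (l : ℂ) (x : (T.subScalar l).domain) (hx : T.subScalar l x ∈ (T.subScalar l).domain),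
    ‖T.subScalar l x‖ ^ 2 ≤ ‖T.subScalar l ⟨T.subScalar l x, hx⟩‖ * ‖(x : H)‖

/-- `μ` is an isolated point of `σ(T)`. -/
def IsIsolatedSpectralPoint (T : H →ₗ.[ℂ] H) (μ : ℂ) : Prop :=
  ∃ ε : ℝ, 0 < ε ∧ Metric.ball μ ε ∩ T.spectrum = {μ}

end LinearPMap

/-! Total paranormality passes to the resolvent `R z`, and a bounded paranormal operator has norm
equal to its spectral radius, so `‖R z‖ ≤ 1 / dist (z, σ(T))`. Near an isolated point `μ` this
bounds `(z - μ) R z`; the singularity is removable and the pole of `R` at most simple. By Cauchy's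
formula the limit `L` is the Riesz projection; closedness of `T` identifies its range with the
eigenspace, and a Neumann series shows `L ≠ 0`. -/

namespace ContinuousLinearMap

variable {E : Type*} [NormedAddCommGroup E] [NormedSpace ℂ E]

/-- The ratios `‖A ^ (n + 1) x‖ / ‖A ^ n x‖` are nondecreasing, hence at least the first one;
cross-multiplying allows zero vectors. -/
theorem norm_apply_mul_norm_pow_apply_le_of_paranormal {A : E →L[ℂ] E}
    (hA : ∀ x, ‖A x‖ ^ 2 ≤ ‖A (A x)‖ * ‖x‖) (x : E) (n : ℕ) :
    ‖A x‖ * ‖(A ^ n) x‖ ≤ ‖(A ^ (n + 1)) x‖ * ‖x‖ := by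
  induction n with
  | zero => simp
  | succ n ih =>
    have hs (m : ℕ) : (A ^ (m + 1)) x = A ((A ^ m) x) := by rw [pow_succ', mul_apply_eq_comp]
    have h := hA ((A ^ n) x)
    rw [hs (n + 1)]
    rw [hs n] at ih ⊢
    rcases eq_or_ne ((A ^ n) x) 0 with h0 | h0
    · simp [h0]
    · have hpos : 0 < ‖(A ^ n) x‖ := norm_pos_iff.2 h0
      refine le_of_mul_le_mul_right ?_ hpos
      calc ‖A x‖ * ‖A ((A ^ n) x)‖ * ‖(A ^ n) x‖
          = ‖A ((A ^ n) x)‖ * (‖A x‖ * ‖(A ^ n) x‖) := by ring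
        _ ≤ ‖A ((A ^ n) x)‖ * (‖A ((A ^ n) x)‖ * ‖x‖) := by gcongr
        _ = ‖A ((A ^ n) x)‖ ^ 2 * ‖x‖ := by ring
        _ ≤ ‖A (A ((A ^ n) x))‖ * ‖(A ^ n) x‖ * ‖x‖ := by gcongr
        _ = ‖A (A ((A ^ n) x))‖ * ‖x‖ * ‖(A ^ n) x‖ := by ring

theorem norm_apply_pow_mul_norm_le_of_paranormal {A : E →L[ℂ] E}
    (hA : ∀ x, ‖A x‖ ^ 2 ≤ ‖A (A x)‖ * ‖x‖) (x : E) (n : ℕ) :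
    ‖A x‖ ^ n * ‖x‖ ≤ ‖(A ^ n) x‖ * ‖x‖ ^ n := by
  induction n with
  | zero => simp
  | succ n ih =>
    calc ‖A x‖ ^ (n + 1) * ‖x‖ = ‖A x‖ * (‖A x‖ ^ n * ‖x‖) := by ring
      _ ≤ ‖A x‖ * (‖(A ^ n) x‖ * ‖x‖ ^ n) := by gcongr
      _ = ‖A x‖ * ‖(A ^ n) x‖ * ‖x‖ ^ n := by ring
      _ ≤ ‖(A ^ (n + 1)) x‖ * ‖x‖ * ‖x‖ ^ n :=
        mul_le_mul_of_nonneg_right (norm_apply_mul_norm_pow_apply_le_of_paranormal hA x n)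
          (by positivity)
      _ = ‖(A ^ (n + 1)) x‖ * ‖x‖ ^ (n + 1) := by ring

/-- A paranormal bounded operator is normaloid. -/
theorem nnnorm_le_spectralRadius_of_paranormal [CompleteSpace E] {A : E →L[ℂ] E}
    (hA : ∀ x, ‖A x‖ ^ 2 ≤ ‖A (A x)‖ * ‖x‖) : (‖A‖₊ : ENNReal) ≤ spectralRadius ℂ A := by
  -- By Gelfand's formula it suffices that `‖A‖ ≤ ‖A ^ n‖ ^ (1 / n)` for `n ≠ 0`.
  refine ge_of_tendsto (spectrum.pow_norm_pow_one_div_tendsto_nhds_spectralRadius A) ?_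
  filter_upwards [Filter.eventually_ne_atTop 0] with n hn
  rw [← ENNReal.ofReal_coe_nnreal, coe_nnnorm]
  refine ENNReal.ofReal_le_ofReal (opNorm_le_bound _ (by positivity) fun x => ?_)
  rcases eq_or_ne x 0 with rfl | hx
  · simp
  have hpos : 0 < ‖x‖ := norm_pos_iff.2 hx
  refine le_of_pow_le_pow_left₀ hn (by positivity) ?_
  rw [mul_pow, one_div, Real.rpow_inv_natCast_pow (norm_nonneg _) hn]
  refine le_of_mul_le_mul_right ?_ hpos
  calc ‖A x‖ ^ n * ‖x‖ ≤ ‖(A ^ n) x‖ * ‖x‖ ^ n :=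
        norm_apply_pow_mul_norm_le_of_paranormal hA x n
    _ ≤ ‖A ^ n‖ * ‖x‖ * ‖x‖ ^ n := by gcongr; exact le_opNorm _ _
    _ = ‖A ^ n‖ * ‖x‖ ^ n * ‖x‖ := by ring

end ContinuousLinearMap

/-! ### Algebra of the resolvent of an unbounded operator -/

namespace LinearPMap

open Filter Topology Metric

variable {H : Type*} [NormedAddCommGroup H] [InnerProductSpace ℂ H] {T : H →ₗ.[ℂ] H} {z w μ : ℂ}

theorem isBoundedInverse_neg_resolvent (hz : z ∈ T.resolventSet) :
    (T.subScalar z).IsBoundedInverse (-T.resolvent z) := by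
  have h : ∃ S : H →L[ℂ] H, (T.subScalar z).IsBoundedInverse S := hz
  rw [resolvent, dif_pos h, neg_neg]
  exact h.choose_spec

theorem resolvent_apply_sub (hz : z ∈ T.resolventSet) (x : T.domain) :
    T.resolvent z (T x - z • (x : H)) = -x :=
  neg_eq_iff_eq_neg.1 ((isBoundedInverse_neg_resolvent hz).1 x)

theorem exists_eq_resolvent_apply (hz : z ∈ T.resolventSet) (y : H) :
    ∃ x : T.domain, (x : H) = T.resolvent z y ∧ T x = z • (x : H) - y := by
  obtain ⟨x, hx, hy⟩ := (isBoundedInverse_neg_resolvent hz).2 (-y)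
  refine ⟨x, by simpa using hx, ?_⟩
  have : T x - z • (x : H) = -y := hy
  rw [sub_eq_iff_eq_add] at this
  rw [this]; abel

theorem resolvent_eq_neg {S : H →L[ℂ] H} (hS : (T.subScalar z).IsBoundedInverse S) :
    T.resolvent z = -S :=
  neg_eq_iff_eq_neg.1 ((isBoundedInverse_neg_resolvent ⟨S, hS⟩).unique hS)

/-- The first resolvent identity. -/
theorem resolvent_sub_resolvent (hz : z ∈ T.resolventSet) (hw : w ∈ T.resolventSet) :
    T.resolvent z - T.resolvent w = (w - z) • (T.resolvent z * T.resolvent w) := by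
  ext y
  obtain ⟨x, hx, hTx⟩ := exists_eq_resolvent_apply hw y
  have h := resolvent_apply_sub hz x
  rw [hTx, sub_right_comm, ← sub_smul, _root_.map_sub, _root_.map_smul, hx] at h
  simp only [_root_.sub_apply, _root_.smul_apply,
    mul_apply_eq_comp]
  rw [sub_eq_iff_eq_add] at h
  rw [h]; abel

theorem isUnit_one_add_smul_resolvent (hz : z ∈ T.resolventSet) (hw : w ∈ T.resolventSet) :
    IsUnit (1 + (w - z) • T.resolvent z) := by
  have h1 := resolvent_sub_resolvent hz hw
  have h2 := resolvent_sub_resolvent hw hz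
  rw [isUnit_iff_exists]
  refine ⟨1 - (w - z) • T.resolvent w, ?_, ?_⟩
  · have : (1 + (w - z) • T.resolvent z) * (1 - (w - z) • T.resolvent w) =
        1 + (w - z) • (T.resolvent z - T.resolvent w -
          (w - z) • (T.resolvent z * T.resolvent w)) := by
      simp only [add_mul, mul_sub, one_mul, mul_one, smul_mul_smul_comm, smul_sub, smul_smul]
      abel
    rw [this, h1, sub_self, smul_zero, add_zero]
  · have : (1 - (w - z) • T.resolvent w) * (1 + (w - z) • T.resolvent z) =
        1 - (w - z) • (T.resolvent w - T.resolvent z -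
          (z - w) • (T.resolvent w * T.resolvent z)) := by
      simp only [sub_mul, mul_add, one_mul, mul_one, smul_mul_smul_comm, smul_sub, smul_smul]
      module
    rw [this, h2, sub_self, smul_zero, sub_zero]

/-- On `D(T)`, `T - w = (1 + (w - z) R z) (T - z)`, so inverting the bounded factor inverts `T - w`.
-/
theorem isBoundedInverse_of_isUnit (hz : z ∈ T.resolventSet)
    (hu : IsUnit (1 + (w - z) • T.resolvent z)) :
    (T.subScalar w).IsBoundedInverse
      (-(T.resolvent z * Ring.inverse (1 + (w - z) • T.resolvent z))) := by
  set U := 1 + (w - z) • T.resolvent z with hU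
  have hcomm : Commute (T.resolvent z) U :=
    (Commute.one_right _).add_right ((Commute.refl _).smul_right _)
  have hinv : T.resolvent z * Ring.inverse U = Ring.inverse U * T.resolvent z := by
    obtain ⟨u, hu'⟩ := hu
    rw [← hu'] at hcomm ⊢
    rw [Ring.inverse_unit]
    exact hcomm.units_inv_right
  refine ⟨fun (x : T.domain) => ?_, fun y => ?_⟩
  · have h : T.resolvent z (T x - w • (x : H)) = -U x := by
      have : T x - w • (x : H) = (T x - z • (x : H)) - (w - z) • (x : H) := by
        rw [sub_smul]; abel
      rw [this, _root_.map_sub, resolvent_apply_sub hz, _root_.map_smul, hU]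
      simp only [_root_.add_apply, _root_.smul_apply,
        one_apply_eq_self]
      abel
    have h' : Ring.inverse U (U x) = x := by
      rw [← mul_apply_eq_comp, Ring.inverse_mul_cancel _ hu,
        one_apply_eq_self]
    change (-(T.resolvent z * Ring.inverse U)) (T x - w • (x : H)) = x
    rw [hinv, _root_.neg_apply, mul_apply_eq_comp, h, _root_.map_neg, neg_neg, h']
  · obtain ⟨x, hx, hTx⟩ := exists_eq_resolvent_apply hz (-Ring.inverse U y)
    refine ⟨x, by rw [hx]; simp, ?_⟩
    have h' : U (Ring.inverse U y) = y := by
      rw [← mul_apply_eq_comp, Ring.mul_inverse_cancel _ hu,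
        one_apply_eq_self]
    change T x - w • (x : H) = y
    rw [hTx, hx, _root_.map_neg]
    refine Eq.trans ?_ h'
    have hUv (v : H) : U v = v + (w - z) • T.resolvent z v := by simp [hU]
    rw [hUv]
    module

theorem spectralRadius_resolvent_le {d : NNReal} (hd : d ≠ 0)
    (hz : ball z d ⊆ T.resolventSet) :
    spectralRadius ℂ (T.resolvent z) ≤ (d⁻¹ : NNReal) := by
  refine iSup₂_le fun k hk => ENNReal.coe_le_coe.2 (not_lt.1 fun hlt => hk ?_)
  have hk0 : k ≠ 0 := by rintro rfl; simp at hlt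
  -- `k - R z = k (1 - k⁻¹ R z)` is the factor for `w = z - k⁻¹`, and `|k| > 1 / d` puts this `w` in
  -- the ball.
  have hmem : z - k⁻¹ ∈ T.resolventSet := hz <| by
    rw [mem_ball, dist_eq_norm, sub_sub_cancel_left, norm_neg, norm_inv, ← coe_nnnorm]
    exact_mod_cast inv_lt_of_inv_lt₀ (pos_iff_ne_zero.2 hd) hlt
  have hzz : z ∈ T.resolventSet := hz (mem_ball_self (NNReal.coe_pos.2 (pos_iff_ne_zero.2 hd)))
  have hu := (isUnit_one_add_smul_resolvent hzz hmem).smul (Units.mk0 k hk0)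
  rw [spectrum.mem_resolventSet_iff]
  convert! hu using 1
  rw [Units.smul_mk0, smul_add, smul_smul, sub_sub_cancel_left, mul_neg, mul_inv_cancel₀ hk0,
    neg_one_smul, Algebra.algebraMap_eq_smul_one, sub_eq_add_neg]

theorem IsTotallyParanormal.paranormal_resolvent (hT : T.IsTotallyParanormal)
    (hz : z ∈ T.resolventSet) (y : H) :
    ‖T.resolvent z y‖ ^ 2 ≤ ‖T.resolvent z (T.resolvent z y)‖ * ‖y‖ := by
  -- The hypothesis is tested on `v = R z (R z y)`, for which `(T - z) v = -R z y` and `(T - z)² v =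
  -- y`.
  obtain ⟨x, hx, hTx⟩ := exists_eq_resolvent_apply hz y
  obtain ⟨v, hv, hTv⟩ := exists_eq_resolvent_apply hz (x : H)
  have h1 : T.subScalar z v = -(x : H) := by rw [subScalar_apply, hTv]; abel
  have h1' (hm) : (⟨T.subScalar z v, hm⟩ : (T.subScalar z).domain) = -x := Subtype.ext h1
  have h2 : T.subScalar z (-x) = y := by
    change T (-x) - z • ((-x : T.domain) : H) = y
    rw [map_neg, hTx, NegMemClass.coe_neg, smul_neg]; abel
  have hm : T.subScalar z v ∈ (T.subScalar z).domain := by rw [h1]; exact neg_mem x.2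
  have h := hT z v hm
  rw [h1', h2, h1, norm_neg, hv, hx] at h
  rwa [mul_comm]

/-! ### Analyticity and growth of the resolvent -/

section Complete

variable [CompleteSpace H]

theorem eventually_isUnit_one_add_smul_resolvent (T : H →ₗ.[ℂ] H) (z : ℂ) :
    ∀ᶠ w in 𝓝 z, IsUnit (1 + (w - z) • T.resolvent z) := by
  have hc : ContinuousAt (fun w : ℂ => 1 + (w - z) • T.resolvent z) z := by fun_prop
  exact hc.eventually (Units.isOpen.mem_nhds (by simp))

theorem differentiableAt_resolvent (hz : z ∈ T.resolventSet) :
    DifferentiableAt ℂ T.resolvent z := by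
  have h : DifferentiableAt ℂ
      (fun w => T.resolvent z * Ring.inverse (1 + (w - z) • T.resolvent z)) z := by
    refine (DifferentiableAt.inverse (by fun_prop) (by simp)).const_mul _
  refine h.congr_of_eventuallyEq ?_
  filter_upwards [eventually_isUnit_one_add_smul_resolvent T z] with w hw
  rw [resolvent_eq_neg (isBoundedInverse_of_isUnit hz hw), neg_neg]

theorem mem_resolventSet_of_norm_mul_lt_one (hz : z ∈ T.resolventSet)
    (h : ‖(z - w) • T.resolvent z‖ < 1) : w ∈ T.resolventSet := by
  refine ⟨_, isBoundedInverse_of_isUnit hz ?_⟩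
  have := isUnit_one_sub_of_norm_lt_one h
  rwa [sub_eq_add_neg, ← neg_smul, neg_sub] at this

/-- For a totally paranormal operator the resolvent satisfies `‖R z‖ ≤ 1 / dist (z, σ(T))`. -/
theorem IsTotallyParanormal.norm_resolvent_le (hT : T.IsTotallyParanormal) {d : NNReal}
    (hd : d ≠ 0) (hz : ball z d ⊆ T.resolventSet) : ‖T.resolvent z‖ ≤ (d : ℝ)⁻¹ := by
  have hzz : z ∈ T.resolventSet := hz (mem_ball_self (NNReal.coe_pos.2 (pos_iff_ne_zero.2 hd)))
  have h := (ContinuousLinearMap.nnnorm_le_spectralRadius_of_paranormal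
    (hT.paranormal_resolvent hzz)).trans (spectralRadius_resolvent_le hd hz)
  exact_mod_cast ENNReal.coe_le_coe.1 h

theorem IsTotallyParanormal.norm_sub_smul_resolvent_le (hT : T.IsTotallyParanormal) {ε : ℝ}
    (hε : ball μ ε \ {μ} ⊆ T.resolventSet) (hz : z ∈ ball μ (ε / 2)) (hne : z ≠ μ) :
    ‖(z - μ) • T.resolvent z‖ ≤ 1 := by
  have hpos : 0 < ‖z - μ‖ := norm_pos_iff.2 (sub_ne_zero.2 hne)
  -- Halving `ε` keeps this ball inside `ball μ ε`; being open, it misses `μ`.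
  have hsub : ball z ‖z - μ‖₊ ⊆ T.resolventSet := fun w hw => hε <| by
    rw [coe_nnnorm] at hw
    rw [mem_ball, dist_eq_norm] at hz
    refine ⟨?_, ?_⟩
    · have := dist_triangle w z μ
      rw [mem_ball, dist_eq_norm z μ |>.symm] at hw
      rw [← dist_eq_norm] at hz
      rw [mem_ball]; linarith
    · rintro rfl
      rw [mem_ball, dist_comm, dist_eq_norm] at hw
      exact lt_irrefl _ hw
  have h := hT.norm_resolvent_le (nnnorm_ne_zero_iff.2 (sub_ne_zero.2 hne)) hsub
  rw [coe_nnnorm] at h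
  rw [norm_smul]
  calc _ ≤ ‖z - μ‖ * ‖z - μ‖⁻¹ := by gcongr
    _ = 1 := mul_inv_cancel₀ hpos.ne'

theorem IsTotallyParanormal.exists_tendsto_sub_smul_resolvent (hT : T.IsTotallyParanormal)
    (hμ : ∀ᶠ z in 𝓝[≠] μ, z ∈ T.resolventSet) :
    ∃ L, Tendsto (fun z => (z - μ) • T.resolvent z) (𝓝[≠] μ) (𝓝 L) := by
  obtain ⟨ε, hε0, hε⟩ := (nhdsWithin_hasBasis nhds_basis_ball _).mem_iff.1 hμ
  refine ⟨_, Complex.tendsto_limUnder_of_differentiable_on_punctured_nhds_of_bounded_under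
    (hμ.mono fun z hz => (by fun_prop : DifferentiableAt ℂ (fun z => z - μ) z).smul
      (differentiableAt_resolvent hz)) (isBoundedUnder_of_eventually_le (a := 1) ?_)⟩
  have hb : ∀ᶠ z in 𝓝[≠] μ, z ∈ ball μ (ε / 2) :=
    mem_nhdsWithin_of_mem_nhds (ball_mem_nhds μ (half_pos hε0))
  filter_upwards [hb, self_mem_nhdsWithin] with z hz hne
  -- The criterion bounds the difference from the value at `μ`, which the factor `z - μ` makes zero.
  rw [sub_self, zero_smul, sub_zero]
  exact hT.norm_sub_smul_resolvent_le hε hz hne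

theorem continuousOn_resolvent : ContinuousOn T.resolvent T.resolventSet := fun _ hz =>
  (differentiableAt_resolvent hz).continuousAt.continuousWithinAt

theorem rieszProjection_eq_of_tendsto {r : ℝ} (hr : 0 < r)
    (hsub : closedBall μ r \ {μ} ⊆ T.resolventSet) {L : H →L[ℂ] H}
    (hL : Tendsto (fun z => (z - μ) • T.resolvent z) (𝓝[≠] μ) (𝓝 L)) :
    T.rieszProjection μ r = L := by
  have hd (z : ℂ) (hz : z ∈ T.resolventSet) :
      DifferentiableAt ℂ (fun z => (z - μ) • T.resolvent z) z :=
    (by fun_prop : DifferentiableAt ℂ (fun z => z - μ) z).smul (differentiableAt_resolvent hz)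
  have h := Complex.circleIntegral_sub_center_inv_smul_of_differentiable_on_off_countable_of_tendsto
    hr Set.countable_empty
    (fun z hz => (hd z (hsub hz)).continuousAt.continuousWithinAt)
    (fun z hz => hd z (hsub ⟨ball_subset_closedBall hz.1.1, hz.1.2⟩)) hL
  have h' : circleIntegral (fun z => (z - μ)⁻¹ • (z - μ) • T.resolvent z) μ r =
      circleIntegral T.resolvent μ r :=
    circleIntegral.integral_congr hr.le fun z hz => by
      have : z - μ ≠ 0 := sub_ne_zero.2 (ne_of_mem_sphere hz hr.ne')
      simp only [smul_smul, inv_mul_cancel₀ this, one_smul]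
  rw [rieszProjection, ← h', h, inv_smul_smul₀ Complex.two_pi_I_ne_zero]

end Complete

/-! ### The residue and the eigenspace -/

theorem mem_nullSpace_subScalar {x : H} :
    x ∈ (T.subScalar μ).nullSpace ↔ ∃ v : T.domain, (v : H) = x ∧ T v = μ • x := by
  simp only [nullSpace, Submodule.mem_map, LinearMap.mem_ker]
  constructor
  · rintro ⟨v, hv, rfl⟩
    exact ⟨v, rfl, sub_eq_zero.1 hv⟩
  · rintro ⟨v, rfl, hv⟩
    exact ⟨v, sub_eq_zero.2 hv, rfl⟩

/-- If the resolvent has at most a simple pole at `μ`, the residue maps onto `N(T - μ I)`. -/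
theorem nullSpace_eq_range_of_tendsto (hclosed : T.IsClosed)
    (hμ : ∀ᶠ z in 𝓝[≠] μ, z ∈ T.resolventSet) {L : H →L[ℂ] H}
    (hL : Tendsto (fun z => (z - μ) • T.resolvent z) (𝓝[≠] μ) (𝓝 L)) :
    (T.subScalar μ).nullSpace = LinearMap.range L.toLinearMap := by
  have hLy (y : H) : Tendsto (fun z => (z - μ) • T.resolvent z y) (𝓝[≠] μ) (𝓝 (L y)) :=
    (((ContinuousLinearMap.apply ℂ H y).continuous.tendsto L).comp hL)
  ext x
  rw [mem_nullSpace_subScalar, LinearMap.mem_range]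
  constructor
  · rintro ⟨v, rfl, hv⟩
    -- On an eigenvector, `(z - μ) R z v = v` for all `z` in the resolvent set, so `L v = v`.
    refine ⟨v, tendsto_nhds_unique (hLy v) (tendsto_const_nhds.congr' ?_)⟩
    filter_upwards [hμ] with z hz
    have h := resolvent_apply_sub hz v
    rw [hv, ← sub_smul, _root_.map_smul, ← neg_sub z μ, neg_smul, neg_inj] at h
    exact h.symm
  · rintro ⟨y, rfl⟩
    have hid : Tendsto (fun z : ℂ => z) (𝓝[≠] μ) (𝓝 μ) := tendsto_nhdsWithin_of_tendsto_nhds tendsto_id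
    have hsub : Tendsto (fun z => z - μ) (𝓝[≠] μ) (𝓝 0) := by
      simpa using hid.sub_const μ
    -- These pairs lie on the graph of `T`, since `T (R z y) = z R z y - y`; closedness puts their
    -- limit there too.
    have hlim : Tendsto (fun z => ((z - μ) • T.resolvent z y,
        z • (z - μ) • T.resolvent z y - (z - μ) • y)) (𝓝[≠] μ) (𝓝 (L y, μ • L y)) := by
      refine (hLy y).prodMk_nhds ?_
      simpa using (hid.smul (hLy y)).sub (hsub.smul_const y)
    have hmem : (L y, μ • L y) ∈ T.graph := by
      refine IsClosed.mem_of_tendsto hclosed hlim ?_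
      filter_upwards [hμ] with z hz
      obtain ⟨v, hv, hTv⟩ := exists_eq_resolvent_apply hz y
      refine (mem_graph_iff T).2 ⟨(z - μ) • v, by simp [hv], ?_⟩
      rw [map_smul, hTv, hv, smul_sub, smul_comm]
    exact (mem_graph_iff T).1 hmem

theorem IsIsolatedSpectralPoint.mem_spectrum (hμ : T.IsIsolatedSpectralPoint μ) :
    μ ∈ T.spectrum := by
  obtain ⟨ε, -, h⟩ := hμ
  exact (h.symm ▸ Set.mem_singleton μ : μ ∈ ball μ ε ∩ T.spectrum).2

theorem sdiff_singleton_subset_resolventSet {s : Set ℂ} (hs : s ∩ T.spectrum = {μ}) :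
    s \ {μ} ⊆ T.resolventSet := fun z hz => by
  by_contra h
  exact hz.2 (hs ▸ ⟨hz.1, h⟩)

theorem IsIsolatedSpectralPoint.eventually_mem_resolventSet (hμ : T.IsIsolatedSpectralPoint μ) :
    ∀ᶠ z in 𝓝[≠] μ, z ∈ T.resolventSet := by
  obtain ⟨ε, hε, h⟩ := hμ
  filter_upwards [mem_nhdsWithin_of_mem_nhds (ball_mem_nhds μ hε), self_mem_nhdsWithin] with z hz hne
  exact sdiff_singleton_subset_resolventSet h ⟨hz, hne⟩

/-- With zero limit, some `z` would have `‖(z - μ) R z‖ < 1`, and the Neumann series at `z` would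
reach `μ`. -/
theorem residue_ne_zero_of_mem_spectrum [CompleteSpace H] (hμ : μ ∈ T.spectrum)
    (hev : ∀ᶠ z in 𝓝[≠] μ, z ∈ T.resolventSet) {L : H →L[ℂ] H}
    (hL : Tendsto (fun z => (z - μ) • T.resolvent z) (𝓝[≠] μ) (𝓝 L)) : L ≠ 0 := by
  rintro rfl
  have h : ∀ᶠ z in 𝓝[≠] μ, ‖(z - μ) • T.resolvent z‖ < 1 :=
    (tendsto_norm_zero.comp hL).eventually (gt_mem_nhds one_pos)
  obtain ⟨z, hz, hlt⟩ := (hev.and h).exists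
  exact hμ (mem_resolventSet_of_norm_mul_lt_one hz hlt)

end LinearPMap

theorem theorem3p4 {H : Type*} [NormedAddCommGroup H] [InnerProductSpace ℂ H] [CompleteSpace H]
    (T : H →ₗ.[ℂ] H) (hdense : Dense (T.domain : Set H)) (hclosed : T.IsClosed)
    (hpara : T.IsTotallyParanormal) (μ : ℂ) (hμ : T.IsIsolatedSpectralPoint μ) :
    (∀ r : ℝ, 0 < r → Metric.closedBall μ r ∩ T.spectrum = {μ} →
      CircleIntegrable T.resolvent μ r ∧
        (T.subScalar μ).nullSpace = LinearMap.range (T.rieszProjection μ r).toLinearMap) ∧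
    μ ∈ T.pointSpectrum := by
  have hev := hμ.eventually_mem_resolventSet
  obtain ⟨L, hL⟩ := hpara.exists_tendsto_sub_smul_resolvent hev
  have hker := LinearPMap.nullSpace_eq_range_of_tendsto hclosed hev hL
  refine ⟨fun r hr hsp => ?_, fun hinj => ?_⟩
  · have hsub := LinearPMap.sdiff_singleton_subset_resolventSet hsp
    refine ⟨(LinearPMap.continuousOn_resolvent.mono fun z hz => hsub
      ⟨Metric.sphere_subset_closedBall hz, Metric.ne_of_mem_sphere hz hr.ne'⟩).circleIntegrable hr.le, ?_⟩
    rw [LinearPMap.rieszProjection_eq_of_tendsto hr hsub hL, hker]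
  · refine LinearPMap.residue_ne_zero_of_mem_spectrum hμ.mem_spectrum hev hL (ContinuousLinearMap.ext fun y => ?_)
    have hy : L y ∈ (T.subScalar μ).nullSpace := hker ▸ ⟨y, rfl⟩
    obtain ⟨v, hv, hTv⟩ := LinearPMap.mem_nullSpace_subScalar.1 hy
    have h0 : v = 0 := hinj <| by
      rw [LinearPMap.subScalar_apply, hTv, hv, sub_self]
      exact (map_zero (T.subScalar μ).toFun).symm
    rw [← hv, h0]
    rfl
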